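/- **Setting.** Let $M=(m_1,\dots,m_l)$ be a list of $n$-qubit Hermitian Pauli operators, measured cyclically; one cycle is one run of $M$, and we start from the trivial stabilizer group. Let $S_j^{(i)}$ ($j\ge 1$, $0\le i\le l$) be the instantaneous stabilizer group (ISG), up to signs, after $m_i$ has been measured in cycle $j$; here $S_j^{(0)}$ is the group at the beginning of cycle $j$. It is obtained from the stabilizer update rule: measuring $m$ keeps the elements that commute with $m$ and adds $m$. The code *is initialized after $k$ cycles* if the ISG at the end of each cycle from cycle $k$ on is the same (for $k=0$: the ISG at the end of every cycle is trivial). A code that needs $k$ cycles to initialize is one for which $k$ is the least such number. Take an ISG $S=S_j^{(i)}$ and a finite list $L$ of Pauli measurements performed after it. A stabilizer $s\in S$ is *unmasked* by $L$ if there is a function of the outcomes of $L$ that gives the eigenvalue of $s$ on $\psi$, for every common eigenvector $\psi$ of $S$ (with arbitrary unknown signs) and every outcome record of nonzero probability when $L$ is measured on $\psi$. It is *permanently masked* by $L$ if it is unmasked neither by $L$ nor by any extension of $L$ by further Pauli measurements. Say that $S=S_j^{(i)}$ is *settled by $B$ measurements* if for every $N\ge B$ the next $N$ measurements of the schedule ($m_{i+1},\dots,m_l,m_1,\dots$)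 have these two properties: every $s\in S$ (in particular every stabilizer generator, for any choice of generators) is unmasked or permanently masked by them; and every $s\in S$ that is unmasked by some number of the next measurements of the schedule is already unmasked by them. **Theorem.** Suppose that the code is initialized after $k$ cycles. 1. It takes at most $k$ cycles to unmask an ISG: every ISG at a cycle boundary is settled by the next $k$ cycles, that is, by $k\,l$ measurements. 2. Every ISG $S_j^{(i)}$ inside a cycle is settled by the end of the $k$-th complete cycle after cycle $j$, that is, by $(l-i)+k\,l$ measurements. 3. Moreover, let $k\ge1$ and $0\le i\le l$ be such that $S_{j'}^{(i)}=S_k^{(i)}$ for all $j'\ge k$ (without any other assumption on $k$). Then every ISG $S_j^{(i)}$, $j\ge1$, is settled by $k\,l$ measurements, that is, by $k$ cycles counted from this very ISG. In particular, if from cycle $k$ on all the ISGs $S_j^{(i)}$, $0\le i\le l$, repeat periodically, then every ISG is settled by $k$ cycles. Consequently the unmasked stabilizers of an ISG are fully determined by $k\,l$ measurements in cases 1 and 3, and by at most $(k+1)\,l$ in case 2; this is $O(1)$ if $k=O(1)$ and $l=O(1)$. -/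

import Mathlib

open scoped Matrix

/-- An `n`-qubit Pauli operator up to phase, written as its binary vector `[a, b]`:
`(a, b)` stands for `∏ⱼ Xⱼ^(aⱼ) Zⱼ^(bⱼ)`. Addition is multiplication up to phase. -/
abbrev Pauli (n : ℕ) : Type := (Fin n → ZMod 2) × (Fin n → ZMod 2)

/-- The symplectic inner product; it is `0` if the operators commute and `1` if they
anticommute. -/
def symp {n : ℕ} (p q : Pauli n) : ZMod 2 := ∑ j, (p.1 j * q.2 j + p.2 j * q.1 j)

/-- All Pauli operators that commute with `m`. -/
def commutant {n : ℕ} (m : Pauli n) : Submodule (ZMod 2) (Pauli n) where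
  carrier := {p | symp p m = 0}
  zero_mem' := by simp [symp]
  add_mem' := by
    intro p q hp hq
    have h : symp (p + q) m = symp p m + symp q m := by
      simp only [symp, ← Finset.sum_add_distrib, Prod.fst_add, Prod.snd_add, Pi.add_apply]
      exact Finset.sum_congr rfl fun j _ => by ring
    simp only [Set.mem_ofPred_eq] at hp hq ⊢
    rw [h, hp, hq, add_zero]
  smul_mem' := by
    intro r p hp
    have h : symp (r • p) m = r * symp p m := by
      simp only [symp, Finset.mul_sum, Prod.smul_fst, Prod.smul_snd, Pi.smul_apply, smul_eq_mul]
      exact Finset.sum_congr rfl fun j _ => by ring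
    simp only [Set.mem_ofPred_eq] at hp ⊢
    rw [h, hp, mul_zero]

/-! ### Instantaneous stabilizer groups -/

/-- The stabilizer update rule for the group `S` (up to signs) under measurement of `m`, in
basis-free form. If `m ∈ S` then `S` (being abelian) is unchanged; if `m ∉ S` commutes with `S`
then `m` is added; if some generator `s₁` anticommutes with `m`, then `s₁` is replaced by `m`
and every other anticommuting generator `sᵢ` by `sᵢ s₁`, that is, the elements of `S` that commute
with `m` are kept and `m` is added. -/
def measureUpdate {n : ℕ} (S : Submodule (ZMod 2) (Pauli n)) (m : Pauli n) :
    Submodule (ZMod 2) (Pauli n) :=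
  (S ⊓ commutant m) ⊔ Submodule.span (ZMod 2) {m}

/-- The stabilizer group after the measurements `L` (in order), starting from `S`. -/
def stabAfter {n : ℕ} (S : Submodule (ZMod 2) (Pauli n)) (L : List (Pauli n)) :
    Submodule (ZMod 2) (Pauli n) :=
  L.foldl measureUpdate S

/-- The instantaneous stabilizer group of the Floquet code with measurement cycle
`M = [m₁, …, m_l]`, after `c` complete cycles and the first `i` measurements of the next one,
starting from the trivial stabilizer group. For `i ≤ l` this is `S_{c+1}^{(i)}`, the group after
measuring `mᵢ` in cycle number `c + 1`. -/
def isg {n : ℕ} (M : List (Pauli n)) (c i : ℕ) : Submodule (ZMod 2) (Pauli n) :=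
  stabAfter ⊥ ((List.replicate c M).flatten ++ M.take i)

/-- The code is initialized after `k` complete cycles: from then on, all ISGs at cycle ends
agree (hence the whole sequence of ISGs repeats with period one cycle). -/
def InitializedAfter {n : ℕ} (M : List (Pauli n)) (k : ℕ) : Prop :=
  ∀ c, k ≤ c → isg M c 0 = isg M k 0

/-- The ISG after `mᵢ` has reached its periodic value in cycle number `k ≥ 1`:
`S_j^{(i)} = S_k^{(i)}` for all `j ≥ k` (here `j = c + 1`). -/
def InitializedAt {n : ℕ} (M : List (Pauli n)) (i k : ℕ) : Prop :=
  1 ≤ k ∧ ∀ c, k ≤ c + 1 → isg M c i = isg M (k - 1) i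

/-- The `N` measurements that follow measurement `mᵢ` in the periodic schedule
`m₁, …, m_l, m₁, …, m_l, …`. -/
def window {n : ℕ} (M : List (Pauli n)) (i N : ℕ) : List (Pauli n) :=
  (M.drop i ++ (List.replicate N M).flatten).take N

/-! ### Quantum mechanics of Pauli measurements -/

/-- (Unnormalized) state vectors of `n` qubits. -/
abbrev State (n : ℕ) : Type := (Fin n → Fin 2) → ℂ

/-- The single-qubit matrices: `I` for `(0,0)`, `X` for `(1,0)`, `Z` for `(0,1)`, `Y` for
`(1,1)`. -/
noncomputable def pauliMatrix (a b : ZMod 2) : Matrix (Fin 2) (Fin 2) ℂ :=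
  if a = 0 then
    if b = 0 then 1 else !![1, 0; 0, -1]
  else
    if b = 0 then !![0, 1; 1, 0] else !![0, -Complex.I; Complex.I, 0]

/-- The Hermitian operator `p₁ ⊗ ⋯ ⊗ pₙ` represented by a binary vector. -/
noncomputable def Pauli.op {n : ℕ} (p : Pauli n) :
    Matrix (Fin n → Fin 2) (Fin n → Fin 2) ℂ :=
  Matrix.of fun r c => ∏ j, pauliMatrix (p.1 j) (p.2 j) (r j) (c j)

/-- The unnormalized state after a record of measurements `m` with outcomes `o = ±1`: each one
applies the projector `(1 + o m) / 2`. The record occurs with nonzero probability on `ψ` iff the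
result is nonzero. -/
noncomputable def collapse {n : ℕ} : List (Pauli n × ℤˣ) → State n → State n
  | [], ψ => ψ
  | (m, o) :: r, ψ => collapse r ((1 / 2 : ℂ) • (ψ + ((o : ℤ) : ℂ) • (m.op *ᵥ ψ)))

/-- `ψ` is a state of the code with stabilizer group `S`: nonzero, and an eigenvector of every
stabilizer, with arbitrary (unknown) signs. -/
def IsCodeState {n : ℕ} (S : Submodule (ZMod 2) (Pauli n)) (ψ : State n) : Prop :=
  ψ ≠ 0 ∧ ∀ s ∈ S, ∃ e : ℤˣ, s.op *ᵥ ψ = ((e : ℤ) : ℂ) • ψ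

/-- The stabilizer `s` of the code `S` is unmasked by the subsequent measurements `L`: its value on
the code state before `L` is a function of the outcomes of `L`. -/
def Unmasked {n : ℕ} (S : Submodule (ZMod 2) (Pauli n)) (L : List (Pauli n)) (s : Pauli n) :
    Prop :=
  ∃ g : List (Pauli n × ℤˣ) → ℤˣ, ∀ ψ : State n, IsCodeState S ψ →
    ∀ r : List (Pauli n × ℤˣ), r.map Prod.fst = L → collapse r ψ ≠ 0 →
      s.op *ᵥ ψ = ((g r : ℤ) : ℂ) • ψ

/-- The stabilizer `s` is permanently masked by the measurements `L`: its value cannot be obtained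
from the outcomes of `L`, nor after adding any further measurements `L'`. -/
def PermanentlyMasked {n : ℕ} (S : Submodule (ZMod 2) (Pauli n)) (L : List (Pauli n))
    (s : Pauli n) : Prop :=
  ∀ L' : List (Pauli n), ¬ Unmasked S (L ++ L') s

/-- `B` measurements following `mᵢ` settle the group `S` (an ISG after `mᵢ`): for every window
of `N ≥ B` measurements, each stabilizer in `S` is unmasked or permanently masked, and each one
that some window (of any length `N'`) unmasks is unmasked by this window. -/
def SettledBy {n : ℕ} (M : List (Pauli n)) (i : ℕ) (S : Submodule (ZMod 2) (Pauli n))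
    (B : ℕ) : Prop :=
  ∀ N, B ≤ N → ∀ s ∈ S,
    (Unmasked S (window M i N) s ∨ PermanentlyMasked S (window M i N) s) ∧
    ∀ N', Unmasked S (window M i N') s → Unmasked S (window M i N) s

/-! ### The symplectic form -/

section Symplectic

variable {n : ℕ}

/-! Fix a record of `L`. Reading `L` backwards from the trivial group gives `R = stabAfter ⊥
L.reverse`, whose operators, applied before `L`, only rescale the final vector. If `s` anticommutes
with some `q ∈ R`, then `ψ` and `qψ` allow the same record with opposite values of `s`, so `s` is
masked. As `R` only grows when `L` is extended, the masking is permanent. If `s ∈ S` commutes with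
`R`, it can be pushed through `L`, becoming, up to a scalar, some `x ∈ stabAfter S L`. When
`stabAfter S L ≤ stabAfter ⊥ L`, the outcomes alone fix the value of `x`, hence that of `s`. So this
inclusion forces the dichotomy (`unmasked_or_permanentlyMasked`), and by monotonicity it survives
longer windows (`settledBy_of_prefix`). Initialization supplies it: the ISG at the end of the window
is also reached from the trivial group by measurements of the window. -/

theorem symp_add_left (p q m : Pauli n) : symp (p + q) m = symp p m + symp q m := by
  simp only [symp, ← Finset.sum_add_distrib, Prod.fst_add, Prod.snd_add, Pi.add_apply]
  exact Finset.sum_congr rfl fun j _ => by ring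

theorem symp_comm (p q : Pauli n) : symp p q = symp q p :=
  Finset.sum_congr rfl fun j _ => by ring

theorem symp_add_right (p q m : Pauli n) : symp m (p + q) = symp m p + symp m q := by
  rw [symp_comm, symp_add_left, symp_comm p, symp_comm q]

theorem symp_zero_left (p : Pauli n) : symp 0 p = 0 := by simp [symp]

theorem symp_self (p : Pauli n) : symp p p = 0 :=
  Finset.sum_eq_zero fun j _ => by rw [mul_comm (p.2 j), CharTwo.add_self_eq_zero]

theorem pauli_add_self (p : Pauli n) : p + p = 0 := by
  ext j <;> exact CharTwo.add_self_eq_zero _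

theorem mem_commutant {p m : Pauli n} : p ∈ commutant m ↔ symp p m = 0 := Iff.rfl

theorem mem_measureUpdate {S : Submodule (ZMod 2) (Pauli n)} {m p : Pauli n} :
    p ∈ measureUpdate S m ↔ ∃ q ∈ S, symp q m = 0 ∧ (p = q ∨ p = q + m) := by
  simp only [measureUpdate, Submodule.mem_sup, Submodule.mem_inf, mem_commutant,
    Submodule.mem_span_singleton]
  constructor
  · rintro ⟨q, ⟨hq, hqm⟩, _, ⟨a, rfl⟩, rfl⟩
    refine ⟨q, hq, hqm, ?_⟩
    have ha : a = 0 ∨ a = 1 := by revert a; decide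
    rcases ha with rfl | rfl <;> simp
  · rintro ⟨q, hq, hqm, rfl | rfl⟩
    · exact ⟨p, ⟨hq, hqm⟩, 0, ⟨0, by simp⟩, by simp⟩
    · exact ⟨q, ⟨hq, hqm⟩, m, ⟨1, by simp⟩, rfl⟩

theorem measureUpdate_mono {S T : Submodule (ZMod 2) (Pauli n)} (h : S ≤ T) (m : Pauli n) :
    measureUpdate S m ≤ measureUpdate T m :=
  sup_le_sup_right (inf_le_inf_right _ h) _

theorem stabAfter_append (S : Submodule (ZMod 2) (Pauli n)) (L L' : List (Pauli n)) :
    stabAfter S (L ++ L') = stabAfter (stabAfter S L) L' :=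
  List.foldl_append

theorem stabAfter_reverse_cons (S : Submodule (ZMod 2) (Pauli n)) (m : Pauli n)
    (L : List (Pauli n)) :
    stabAfter S (m :: L).reverse = measureUpdate (stabAfter S L.reverse) m := by
  rw [List.reverse_cons, stabAfter_append]; rfl

/-- This gives both the growth of the backward group and the persistence of `stabAfter S L ≤
stabAfter ⊥ L` under extension of `L`. -/
theorem stabAfter_mono {S T : Submodule (ZMod 2) (Pauli n)} (h : S ≤ T) (L : List (Pauli n)) :
    stabAfter S L ≤ stabAfter T L := by
  induction L generalizing S T with
  | nil => exact h
  | cons m L ih => exact ih (measureUpdate_mono h m)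

/-- If `s` commutes with the group obtained from `W` by measuring `m`, then `s` commutes with `m`,
and `s` or `s + m` commutes with `W`. -/
theorem commutes_of_commutes_measureUpdate {W : Submodule (ZMod 2) (Pauli n)} {m s : Pauli n}
    (h : ∀ q ∈ measureUpdate W m, symp s q = 0) :
    symp s m = 0 ∧ ((∀ q ∈ W, symp s q = 0) ∨ ∀ q ∈ W, symp (s + m) q = 0) := by
  have hm : symp s m = 0 :=
    h m (mem_measureUpdate.2 ⟨0, W.zero_mem, symp_zero_left m, Or.inr (zero_add m).symm⟩)
  have hW : ∀ q ∈ W, symp q m = 0 → symp s q = 0 := fun q hq hqm =>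
    h q (mem_measureUpdate.2 ⟨q, hq, hqm, Or.inl rfl⟩)
  have h2 : ∀ a : ZMod 2, a ≠ 0 → a = 1 := by decide
  refine ⟨hm, ?_⟩
  by_contra! hcon
  obtain ⟨⟨q, hq, hsq⟩, q', hq', hsq'⟩ := hcon
  have h1 : symp q m = 1 := h2 _ fun h0 => hsq (hW q hq h0)
  rw [symp_add_left] at hsq'
  rcases eq_or_ne (symp q' m) 0 with h0 | h0
  · rw [symp_comm m, h0, hW q' hq' h0] at hsq'
    exact hsq' (add_zero 0)
  -- Both `q` and `q'` anticommute with `m`, so `q + q'` commutes with `m` and hence with `s`; thus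
  -- `s` anticommutes with `q'` too, and `s + m` commutes with it.
  · have h3 := hW (q + q') (W.add_mem hq hq') (by
      rw [symp_add_left, h1, h2 _ h0]; decide)
    rw [symp_add_right, h2 _ hsq] at h3
    rw [symp_comm m, h2 _ h0, add_comm, h3] at hsq'
    exact hsq' rfl

end Symplectic

/-! ### Algebra of Pauli operators -/

section Operators

variable {n : ℕ}

/-- The tensor product of single-qubit matrices. -/
def tensorMatrix (A : Fin n → Matrix (Fin 2) (Fin 2) ℂ) :
    Matrix (Fin n → Fin 2) (Fin n → Fin 2) ℂ :=
  Matrix.of fun r c => ∏ j, A j (r j) (c j)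

theorem tensorMatrix_mul (A B : Fin n → Matrix (Fin 2) (Fin 2) ℂ) :
    tensorMatrix A * tensorMatrix B = tensorMatrix fun j => A j * B j := by
  ext r c
  simp only [tensorMatrix, Matrix.mul_apply, Matrix.of_apply, ← Finset.prod_mul_distrib]
  rw [Finset.prod_univ_sum, Fintype.piFinset_univ]

theorem tensorMatrix_smul (a : Fin n → ℂ) (A : Fin n → Matrix (Fin 2) (Fin 2) ℂ) :
    tensorMatrix (fun j => a j • A j) = (∏ j, a j) • tensorMatrix A := by
  ext r c
  simp [tensorMatrix, Finset.prod_mul_distrib]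

theorem tensorMatrix_one : tensorMatrix (fun _ : Fin n => 1) = 1 := by
  ext r c
  simp only [tensorMatrix, Matrix.of_apply, Matrix.one_apply, Finset.prod_ite_zero]
  simp [funext_iff]

theorem Pauli.op_eq_tensorMatrix (p : Pauli n) :
    p.op = tensorMatrix fun j => pauliMatrix (p.1 j) (p.2 j) := rfl

theorem Pauli.op_zero : (0 : Pauli n).op = 1 := by
  rw [Pauli.op_eq_tensorMatrix, ← tensorMatrix_one]
  simp [pauliMatrix]

theorem zmod_two_cases (a : ZMod 2) : a = 0 ∨ a = 1 := by revert a; decide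

theorem pauliMatrix_mul_self (a b : ZMod 2) : pauliMatrix a b * pauliMatrix a b = 1 := by
  rcases zmod_two_cases a with rfl | rfl <;> rcases zmod_two_cases b with rfl | rfl <;>
    ext i j <;> fin_cases i <;> fin_cases j <;> simp [pauliMatrix, Matrix.mul_apply]

theorem pauliMatrix_mul (a b a' b' : ZMod 2) :
    ∃ z : ℂ, pauliMatrix a b * pauliMatrix a' b' = z • pauliMatrix (a + a') (b + b') := by
  have h2 : (1 + 1 : ZMod 2) = 0 := rfl
  rcases zmod_two_cases a with rfl | rfl <;> rcases zmod_two_cases b with rfl | rfl <;>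
    rcases zmod_two_cases a' with rfl | rfl <;> rcases zmod_two_cases b' with rfl | rfl <;>
    first
    | (refine ⟨1, ?_⟩; ext i j
       fin_cases i <;> fin_cases j <;> simp [pauliMatrix, Matrix.mul_apply, h2]; done)
    | (refine ⟨Complex.I, ?_⟩; ext i j
       fin_cases i <;> fin_cases j <;> simp [pauliMatrix, Matrix.mul_apply, h2]; done)
    | (refine ⟨-Complex.I, ?_⟩; ext i j
       fin_cases i <;> fin_cases j <;> simp [pauliMatrix, Matrix.mul_apply, h2])

/-- The sign `(-1)^a`. -/
def zmodSign (a : ZMod 2) : ℂ := if a = 0 then 1 else -1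

theorem zmodSign_add (a b : ZMod 2) : zmodSign (a + b) = zmodSign a * zmodSign b := by
  have h2 : (1 + 1 : ZMod 2) = 0 := rfl
  rcases zmod_two_cases a with rfl | rfl <;> rcases zmod_two_cases b with rfl | rfl <;>
    simp [zmodSign, h2]

theorem zmodSign_sum {ι : Type*} (t : Finset ι) (f : ι → ZMod 2) :
    zmodSign (∑ j ∈ t, f j) = ∏ j ∈ t, zmodSign (f j) := by
  classical
  induction t using Finset.induction_on with
  | empty => simp [zmodSign]
  | insert a t ha ih => rw [Finset.sum_insert ha, Finset.prod_insert ha, zmodSign_add, ih]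

theorem pauliMatrix_mul_comm (a b a' b' : ZMod 2) :
    pauliMatrix a b * pauliMatrix a' b' =
      zmodSign (a * b' + b * a') • (pauliMatrix a' b' * pauliMatrix a b) := by
  have h2 : (1 + 1 : ZMod 2) = 0 := rfl
  rcases zmod_two_cases a with rfl | rfl <;> rcases zmod_two_cases b with rfl | rfl <;>
    rcases zmod_two_cases a' with rfl | rfl <;> rcases zmod_two_cases b' with rfl | rfl <;>
    ext i j <;> fin_cases i <;> fin_cases j <;>
    simp [pauliMatrix, Matrix.mul_apply, h2, zmodSign]

theorem Pauli.op_mul_self (p : Pauli n) : p.op * p.op = 1 := by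
  simp only [Pauli.op_eq_tensorMatrix, tensorMatrix_mul, pauliMatrix_mul_self, tensorMatrix_one]

theorem Pauli.op_mul_comm (p q : Pauli n) : p.op * q.op = zmodSign (symp p q) • (q.op * p.op) := by
  simp only [Pauli.op_eq_tensorMatrix, tensorMatrix_mul, symp, zmodSign_sum]
  rw [← tensorMatrix_smul]
  congr 1
  funext j
  exact pauliMatrix_mul_comm _ _ _ _

theorem Pauli.op_mul (p q : Pauli n) : ∃ z : ℂ, p.op * q.op = z • (p + q).op := by
  choose z hz using fun j => pauliMatrix_mul (p.1 j) (p.2 j) (q.1 j) (q.2 j)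
  refine ⟨∏ j, z j, ?_⟩
  simp only [Pauli.op_eq_tensorMatrix, tensorMatrix_mul, hz]
  exact tensorMatrix_smul _ _

theorem Pauli.op_mulVec_op_mulVec_self (p : Pauli n) (ψ : State n) : p.op *ᵥ p.op *ᵥ ψ = ψ := by
  rw [Matrix.mulVec_mulVec, op_mul_self, Matrix.one_mulVec]

theorem Pauli.op_mulVec_comm {p q : Pauli n} (h : symp p q = 0) (ψ : State n) :
    p.op *ᵥ q.op *ᵥ ψ = q.op *ᵥ p.op *ᵥ ψ := by
  rw [Matrix.mulVec_mulVec, op_mul_comm, h, zmodSign, if_pos rfl, one_smul, Matrix.mulVec_mulVec]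

theorem Pauli.op_mulVec_ne_zero (p : Pauli n) {ψ : State n} (h : ψ ≠ 0) : p.op *ᵥ ψ ≠ 0 := by
  intro h0
  apply h
  rw [← p.op_mulVec_op_mulVec_self ψ, h0, Matrix.mulVec_zero]

/-- Applying `Pauli.op_mul` to `p` and `p + q` puts the phase on this side, so it need not be
inverted. -/
theorem Pauli.op_add (p q : Pauli n) :
    ∃ z : ℂ, ∀ ψ : State n, (p + q).op *ᵥ ψ = z • (p.op *ᵥ q.op *ᵥ ψ) := by
  obtain ⟨z, hz⟩ := Pauli.op_mul p (p + q)
  rw [← add_assoc, pauli_add_self, zero_add] at hz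
  refine ⟨z, fun ψ => ?_⟩
  rw [← Matrix.mulVec_smul, ← Matrix.smul_mulVec, ← hz, Matrix.mulVec_mulVec, ← mul_assoc,
    op_mul_self, one_mul]

theorem sign_of_eigenvector {p : Pauli n} {ψ : State n} (h : ψ ≠ 0) {z : ℂ}
    (hz : p.op *ᵥ ψ = z • ψ) : ∃ e : ℤˣ, p.op *ᵥ ψ = ((e : ℤ) : ℂ) • ψ := by
  have h1 : (z * z) • ψ = (1 : ℂ) • ψ := by
    rw [mul_smul, ← hz, ← Matrix.mulVec_smul, ← hz, p.op_mulVec_op_mulVec_self, one_smul]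
  rcases mul_self_eq_one_iff.1 (smul_left_injective ℂ h h1) with rfl | rfl
  · exact ⟨1, by simpa using hz⟩
  · exact ⟨-1, by simpa using hz⟩

end Operators

/-! ### Measurement records -/

section Records

variable {n : ℕ}

/-- The unnormalized state after measuring `m` with outcome `o`. -/
noncomputable def project (m : Pauli n) (o : ℤˣ) (ψ : State n) : State n :=
  (1 / 2 : ℂ) • (ψ + ((o : ℤ) : ℂ) • (m.op *ᵥ ψ))

theorem collapse_cons (m : Pauli n) (o : ℤˣ) (r : List (Pauli n × ℤˣ)) (ψ : State n) :
    collapse ((m, o) :: r) ψ = collapse r (project m o ψ) := rfl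

theorem project_smul (m : Pauli n) (o : ℤˣ) (z : ℂ) (ψ : State n) :
    project m o (z • ψ) = z • project m o ψ := by
  rw [project, project, Matrix.mulVec_smul, smul_comm _ z, ← smul_add, smul_comm _ z]

theorem collapse_smul (r : List (Pauli n × ℤˣ)) (z : ℂ) (ψ : State n) :
    collapse r (z • ψ) = z • collapse r ψ := by
  induction r generalizing ψ with
  | nil => rfl
  | cons a r ih => obtain ⟨m, o⟩ := a; rw [collapse_cons, project_smul, ih, collapse_cons]

theorem collapse_append (r r' : List (Pauli n × ℤˣ)) (ψ : State n) :
    collapse (r ++ r') ψ = collapse r' (collapse r ψ) := by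
  induction r generalizing ψ with
  | nil => rfl
  | cons a r ih => obtain ⟨m, o⟩ := a; rw [List.cons_append, collapse_cons, ih, collapse_cons]

theorem collapse_zero (r : List (Pauli n × ℤˣ)) : collapse r (0 : State n) = 0 := by
  simpa using collapse_smul r 0 0

theorem project_op_mulVec {m q : Pauli n} (h : symp q m = 0) (o : ℤˣ) (ψ : State n) :
    project m o (q.op *ᵥ ψ) = q.op *ᵥ project m o ψ := by
  rw [project, project, ← Pauli.op_mulVec_comm h, Matrix.mulVec_smul, Matrix.mulVec_add,
    Matrix.mulVec_smul]

theorem op_mulVec_project (m : Pauli n) (o : ℤˣ) (ψ : State n) :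
    m.op *ᵥ project m o ψ = ((o : ℤ) : ℂ) • project m o ψ := by
  have ho : ((o : ℤ) : ℂ) * ((o : ℤ) : ℂ) = 1 := by
    rcases Int.units_eq_one_or o with rfl | rfl <;> simp
  rw [project, Matrix.mulVec_smul, Matrix.mulVec_add, Matrix.mulVec_smul,
    m.op_mulVec_op_mulVec_self, smul_comm ((o : ℤ) : ℂ) (1 / 2 : ℂ),
    smul_add ((o : ℤ) : ℂ), smul_smul ((o : ℤ) : ℂ), ho, one_smul, add_comm]

/-- The projections for the two outcomes sum to `ψ`. -/
theorem exists_project_ne_zero (m : Pauli n) {ψ : State n} (h : ψ ≠ 0) :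
    ∃ o : ℤˣ, project m o ψ ≠ 0 := by
  by_contra! hcon
  apply h
  have h1 : ψ = project m 1 ψ + project m (-1) ψ := by
    ext c
    simp [project]
    ring
  rw [h1, hcon, hcon, add_zero]

theorem exists_collapse_ne_zero (L : List (Pauli n)) {ψ : State n} (h : ψ ≠ 0) :
    ∃ r : List (Pauli n × ℤˣ), r.map Prod.fst = L ∧ collapse r ψ ≠ 0 := by
  induction L generalizing ψ with
  | nil => exact ⟨[], rfl, h⟩
  | cons m L ih =>
    obtain ⟨o, ho⟩ := exists_project_ne_zero m h
    obtain ⟨r, hr, hr0⟩ := ih ho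
    exact ⟨(m, o) :: r, by simp [hr], hr0⟩

/-- If every element of `W` has the same eigenvalue on all states of a family, then so does every
element of the updated group on the states after a measurement record. -/
theorem exists_eigenvalue_of_mem_stabAfter {ι : Type*} (ψ : ι → State n)
    (W : Submodule (ZMod 2) (Pauli n))
    (hW : ∀ y ∈ W, ∃ d : ℂ, ∀ a, y.op *ᵥ ψ a = d • ψ a)
    (r : List (Pauli n × ℤˣ)) {y : Pauli n} (hy : y ∈ stabAfter W (r.map Prod.fst)) :
    ∃ d : ℂ, ∀ a, y.op *ᵥ collapse r (ψ a) = d • collapse r (ψ a) := by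
  induction r generalizing ψ W with
  | nil => exact hW y hy
  | cons b r ih =>
    obtain ⟨m, o⟩ := b
    refine ih (fun a => project m o (ψ a)) (measureUpdate W m) (fun p hp => ?_) hy
    obtain ⟨q, hq, hqm, rfl | rfl⟩ := mem_measureUpdate.1 hp
    · obtain ⟨d, hd⟩ := hW p hq
      exact ⟨d, fun a => by rw [← project_op_mulVec hqm, hd, project_smul]⟩
    · obtain ⟨d, hd⟩ := hW q hq
      obtain ⟨z, hz⟩ := Pauli.op_add q m
      refine ⟨z * (o : ℤ) * d, fun a => ?_⟩
      rw [hz, op_mulVec_project, Matrix.mulVec_smul, ← project_op_mulVec hqm, hd, project_smul,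
        smul_smul, smul_smul, mul_assoc]

/-- An operator of the group obtained by the update rule along the reversed list acts trivially
before the measurements. -/
theorem collapse_op_mulVec_of_mem_reverse (r : List (Pauli n × ℤˣ)) {q : Pauli n}
    (hq : q ∈ stabAfter ⊥ (r.map Prod.fst).reverse) :
    ∃ z : ℂ, ∀ ψ : State n, collapse r (q.op *ᵥ ψ) = z • collapse r ψ := by
  induction r generalizing q with
  | nil =>
    obtain rfl : q = 0 := hq
    exact ⟨1, fun ψ => by rw [Pauli.op_zero, Matrix.one_mulVec, one_smul]⟩
  | cons b r ih =>
    obtain ⟨m, o⟩ := b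
    rw [List.map_cons, stabAfter_reverse_cons] at hq
    obtain ⟨p, hp, hpm, rfl | rfl⟩ := mem_measureUpdate.1 hq
    · obtain ⟨z, hz⟩ := ih hp
      exact ⟨z, fun ψ => by rw [collapse_cons, project_op_mulVec hpm, hz, collapse_cons]⟩
    · obtain ⟨z, hz⟩ := ih hp
      obtain ⟨w, hw⟩ := Pauli.op_add p m
      refine ⟨w * (o : ℤ) * z, fun ψ => ?_⟩
      rw [hw, collapse_cons, project_smul, project_op_mulVec hpm, project_op_mulVec (symp_self m),
        op_mulVec_project, Matrix.mulVec_smul, collapse_smul, collapse_smul, hz, smul_smul,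
        smul_smul, collapse_cons]

/-- An operator that commutes with the group of the reversed list can be moved through the
measurements. -/
theorem collapse_op_mulVec_of_commutes (S : Submodule (ZMod 2) (Pauli n))
    (r : List (Pauli n × ℤˣ)) {s : Pauli n} (hs : s ∈ S)
    (h : ∀ q ∈ stabAfter ⊥ (r.map Prod.fst).reverse, symp s q = 0) :
    ∃ x ∈ stabAfter S (r.map Prod.fst), ∃ z : ℂ, ∀ ψ : State n,
      collapse r (s.op *ᵥ ψ) = z • (x.op *ᵥ collapse r ψ) := by
  induction r generalizing S s with
  | nil => exact ⟨s, hs, 1, fun ψ => (one_smul _ _).symm⟩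
  | cons b r ih =>
    obtain ⟨m, o⟩ := b
    rw [List.map_cons, stabAfter_reverse_cons] at h
    obtain ⟨hsm, h | h⟩ := commutes_of_commutes_measureUpdate h
    · obtain ⟨x, hx, z, hz⟩ :=
        ih (measureUpdate S m) (mem_measureUpdate.2 ⟨s, hs, hsm, Or.inl rfl⟩) h
      exact ⟨x, hx, z, fun ψ => by rw [collapse_cons, project_op_mulVec hsm, hz, collapse_cons]⟩
    -- Here `s + m` is carried on; the missing factor `m` becomes the outcome `o` on the projected
    -- state.
    · obtain ⟨x, hx, z, hz⟩ :=
        ih (measureUpdate S m) (mem_measureUpdate.2 ⟨s, hs, hsm, Or.inr rfl⟩) h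
      obtain ⟨w, hw⟩ := Pauli.op_add (s + m) m
      rw [add_assoc, pauli_add_self, add_zero] at hw
      refine ⟨x, hx, w * (o : ℤ) * z, fun ψ => ?_⟩
      rw [collapse_cons, project_op_mulVec hsm, hw, op_mulVec_project, Matrix.mulVec_smul,
        collapse_smul, collapse_smul, hz, smul_smul, smul_smul, collapse_cons]

end Records

/-! ### Unmasked and permanently masked stabilizers -/

section Masking

variable {n : ℕ}

theorem exists_isCodeState_stabAfter_bot (L : List (Pauli n)) :
    ∃ ψ : State n, IsCodeState (stabAfter ⊥ L) ψ := by
  obtain ⟨r, rfl, hr0⟩ := exists_collapse_ne_zero L (one_ne_zero : (1 : State n) ≠ 0)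
  refine ⟨_, hr0, fun s hs => ?_⟩
  obtain ⟨d, hd⟩ := exists_eigenvalue_of_mem_stabAfter (fun _ : Unit => (1 : State n)) ⊥
    (fun y hy => ⟨1, fun _ => by
      rw [(Submodule.mem_bot _).1 hy, Pauli.op_zero, Matrix.one_mulVec, one_smul]⟩) r hs
  exact sign_of_eigenvector hr0 (hd ())

/-- A Pauli operator only flips signs of stabilizers, and code states allow all signs. -/
theorem IsCodeState.op_mulVec {S : Submodule (ZMod 2) (Pauli n)} {ψ : State n}
    (h : IsCodeState S ψ) (q : Pauli n) : IsCodeState S (q.op *ᵥ ψ) := by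
  refine ⟨q.op_mulVec_ne_zero h.1, fun s hs => ?_⟩
  obtain ⟨e, he⟩ := h.2 s hs
  refine sign_of_eigenvector (z := zmodSign (symp s q) * (e : ℤ)) (q.op_mulVec_ne_zero h.1) ?_
  rw [Matrix.mulVec_mulVec, Pauli.op_mul_comm, Matrix.smul_mulVec, ← Matrix.mulVec_mulVec, he,
    Matrix.mulVec_smul, smul_smul]

theorem Unmasked.append {S : Submodule (ZMod 2) (Pauli n)} {L : List (Pauli n)} {s : Pauli n}
    (h : Unmasked S L s) (L' : List (Pauli n)) : Unmasked S (L ++ L') s := by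
  obtain ⟨g, hg⟩ := h
  refine ⟨fun r => g (r.take L.length), fun ψ hψ r hr hr0 => ?_⟩
  -- A record of nonzero probability has initial segments of nonzero probability.
  refine hg ψ hψ _ (by rw [List.map_take, hr, List.take_left]) fun h0 => hr0 ?_
  rw [← List.take_append_drop L.length r, collapse_append, h0, collapse_zero]

/-- An unmasked stabilizer commutes with every operator that acts trivially before the
measurements. -/
theorem Unmasked.symp_eq_zero {S : Submodule (ZMod 2) (Pauli n)} {L : List (Pauli n)}
    {s : Pauli n} (hS : ∃ ψ : State n, IsCodeState S ψ) (h : Unmasked S L s) {q : Pauli n}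
    (hq : q ∈ stabAfter ⊥ L.reverse) : symp s q = 0 := by
  obtain ⟨g, hg⟩ := h
  obtain ⟨ψ, hψ⟩ := hS
  obtain ⟨r, rfl, hr0⟩ := exists_collapse_ne_zero L hψ.1
  obtain ⟨z, hz⟩ := collapse_op_mulVec_of_mem_reverse r hq
  have hz0 : z ≠ 0 := by
    rintro rfl
    apply hr0
    rw [← q.op_mulVec_op_mulVec_self ψ, hz, zero_smul]
  have h1 := hg ψ hψ r rfl hr0
  have h2 := hg (q.op *ᵥ ψ) (hψ.op_mulVec q) r rfl (by rw [hz]; exact smul_ne_zero hz0 hr0)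
  by_contra hsq
  rw [Matrix.mulVec_mulVec, Pauli.op_mul_comm, Matrix.smul_mulVec, ← Matrix.mulVec_mulVec, h1,
    Matrix.mulVec_smul, smul_smul, zmodSign, if_neg hsq] at h2
  have h3 := smul_left_injective ℂ (q.op_mulVec_ne_zero hψ.1) h2
  rcases Int.units_eq_one_or (g r) with h4 | h4 <;> rw [h4] at h3 <;> norm_num at h3

/-- If every current stabilizer has a value given by the outcomes, then a stabilizer that commutes
with the operators acting trivially before the measurements is unmasked. -/
theorem unmasked_of_commutes {S : Submodule (ZMod 2) (Pauli n)} {L : List (Pauli n)}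
    {s : Pauli n} (hL : stabAfter S L ≤ stabAfter ⊥ L) (hs : s ∈ S)
    (h : ∀ q ∈ stabAfter ⊥ L.reverse, symp s q = 0) : Unmasked S L s := by
  have key : ∀ r : List (Pauli n × ℤˣ), r.map Prod.fst = L → ∃ d : ℂ, ∀ ψ : State n,
      collapse r (s.op *ᵥ ψ) = d • collapse r ψ := by
    rintro r rfl
    obtain ⟨x, hx, z, hz⟩ := collapse_op_mulVec_of_commutes S r hs h
    -- Taking all vectors as the family makes `d` depend on the record only.
    obtain ⟨d, hd⟩ := exists_eigenvalue_of_mem_stabAfter (fun ψ : State n => ψ) ⊥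
      (fun y hy => ⟨1, fun _ => by
        rw [(Submodule.mem_bot _).1 hy, Pauli.op_zero, Matrix.one_mulVec, one_smul]⟩) r (hL hx)
    exact ⟨z * d, fun ψ => by rw [hz, hd, smul_smul]⟩
  have sign : ∀ r : List (Pauli n × ℤˣ), ∃ e : ℤˣ, ∀ ψ : State n, IsCodeState S ψ →
      r.map Prod.fst = L → collapse r ψ ≠ 0 → s.op *ᵥ ψ = ((e : ℤ) : ℂ) • ψ := by
    intro r
    -- One compatible code state fixes the sign for all, by `key`; impossible records get the value
    -- `1`.
    by_cases hr : ∃ ψ : State n, IsCodeState S ψ ∧ r.map Prod.fst = L ∧ collapse r ψ ≠ 0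
    · obtain ⟨φ, hφ, hrL, hr0⟩ := hr
      obtain ⟨d, hd⟩ := key r hrL
      have hval : ∀ {ψ : State n} {e : ℤˣ}, collapse r ψ ≠ 0 →
          s.op *ᵥ ψ = ((e : ℤ) : ℂ) • ψ → ((e : ℤ) : ℂ) = d := by
        intro ψ e h0 he
        have h1 := hd ψ
        rw [he, collapse_smul] at h1
        exact smul_left_injective ℂ h0 h1
      obtain ⟨e, he⟩ := hφ.2 s hs
      refine ⟨e, fun ψ hψ _ h0 => ?_⟩
      obtain ⟨e', he'⟩ := hψ.2 s hs
      rw [he', hval h0 he', hval hr0 he]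
    · exact ⟨1, fun ψ hψ hrL h0 => (hr ⟨ψ, hψ, hrL, h0⟩).elim⟩
  choose g hg using sign
  exact ⟨g, fun ψ hψ r hr hr0 => hg r ψ hψ hr hr0⟩

theorem unmasked_or_permanentlyMasked {S : Submodule (ZMod 2) (Pauli n)} {L : List (Pauli n)}
    (hS : ∃ ψ : State n, IsCodeState S ψ) (hL : stabAfter S L ≤ stabAfter ⊥ L)
    {s : Pauli n} (hs : s ∈ S) : Unmasked S L s ∨ PermanentlyMasked S L s := by
  by_cases h : ∀ q ∈ stabAfter ⊥ L.reverse, symp s q = 0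
  · exact Or.inl (unmasked_of_commutes hL hs h)
  · refine Or.inr fun L' hL' => h fun q hq => hL'.symp_eq_zero hS ?_
    rw [List.reverse_append, stabAfter_append]
    exact stabAfter_mono bot_le _ hq

end Masking

/-! ### Windows of the periodic schedule -/

section Schedule

variable {n : ℕ}

theorem flatten_replicate_add {α : Type*} (M : List α) (a b : ℕ) :
    (List.replicate (a + b) M).flatten =
      (List.replicate a M).flatten ++ (List.replicate b M).flatten := by
  rw [List.replicate_add, List.flatten_append]

theorem flatten_replicate_prefix {α : Type*} (M : List α) {a b : ℕ} (h : a ≤ b) :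
    (List.replicate a M).flatten <+: (List.replicate b M).flatten := by
  obtain ⟨c, rfl⟩ := Nat.exists_eq_add_of_le h
  exact ⟨_, (flatten_replicate_add M a c).symm⟩

theorem window_prefix (M : List (Pauli n)) (i : ℕ) {N N' : ℕ} (h : N ≤ N') :
    window M i N <+: window M i N' := by
  refine List.prefix_take_iff.2 ⟨(List.take_prefix _ _).trans ?_,
    (List.length_take_le _ _).trans h⟩
  exact (List.prefix_append_right_inj _).2 (flatten_replicate_prefix M h)

theorem prefix_window (M : List (Pauli n)) (i j : ℕ) {W : List (Pauli n)} {N : ℕ}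
    (hW : W <+: M.drop i ++ (List.replicate j M).flatten) (hj : j * M.length ≤ N)
    (hN : W.length ≤ N) : W <+: window M i N := by
  refine List.prefix_take_iff.2 ⟨hW.trans ((List.prefix_append_right_inj _).2 ?_), hN⟩
  -- For empty `M` the bound `hj` does not control `j`, but all the lists are empty.
  rcases Nat.eq_zero_or_pos M.length with h0 | h0
  · simp [List.length_eq_zero_iff.1 h0]
  · exact flatten_replicate_prefix M ((Nat.le_mul_of_pos_right j h0).trans hj)

theorem settledBy_of_prefix (M : List (Pauli n)) (i B : ℕ) {S : Submodule (ZMod 2) (Pauli n)}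
    (hS : ∃ ψ : State n, IsCodeState S ψ) {W : List (Pauli n)}
    (hW : stabAfter S W ≤ stabAfter ⊥ W) (hpre : ∀ N, B ≤ N → W <+: window M i N) :
    SettledBy M i S B := by
  intro N hN s hs
  have hdich : Unmasked S (window M i N) s ∨ PermanentlyMasked S (window M i N) s := by
    obtain ⟨L', hL'⟩ := hpre N hN
    refine unmasked_or_permanentlyMasked hS ?_ hs
    rw [← hL', stabAfter_append, stabAfter_append]
    exact stabAfter_mono hW L'
  refine ⟨hdich, fun N' hN' => hdich.resolve_right fun hperm => ?_⟩
  rcases le_total N N' with h | h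
  · obtain ⟨L', hL'⟩ := window_prefix M i h
    exact hperm L' (hL' ▸ hN')
  · obtain ⟨L', hL'⟩ := window_prefix M i h
    -- The extra `[]` matches the form `L ++ L'` in `PermanentlyMasked`.
    have := (hN'.append L').append []
    rw [hL'] at this
    exact hperm [] this

theorem isg_zero (M : List (Pauli n)) (c : ℕ) :
    isg M c 0 = stabAfter ⊥ (List.replicate c M).flatten := by
  simp [isg]

theorem stabAfter_isg_zero (M : List (Pauli n)) (c k : ℕ) :
    stabAfter (isg M c 0) (List.replicate k M).flatten = isg M (c + k) 0 := by
  rw [isg_zero, isg_zero, ← stabAfter_append, ← flatten_replicate_add]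

theorem stabAfter_isg_drop (M : List (Pauli n)) (c i : ℕ) :
    stabAfter (isg M c i) (M.drop i) = isg M (c + 1) 0 := by
  rw [isg, ← stabAfter_append, List.append_assoc, List.take_append_drop, isg_zero,
    flatten_replicate_add]
  simp

theorem isg_eq_stabAfter_take (M : List (Pauli n)) (c i : ℕ) :
    isg M c i = stabAfter (isg M c 0) (M.take i) := by
  rw [isg_zero, ← stabAfter_append]; rfl

end Schedule

theorem mainTheorem9 {n : ℕ} (M : List (Pauli n)) (k : ℕ) :
    -- ISGs at cycle ends: `k` cycles
    (InitializedAfter M k → ∀ c, SettledBy M 0 (isg M c 0) (k * M.length)) ∧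
    -- any ISG: the rest of the current cycle and then `k` cycles
    (InitializedAfter M k → ∀ c i, i ≤ M.length →
      SettledBy M i (isg M c i) ((M.length - i) + k * M.length)) ∧
    -- any ISG at a position that is initialized in cycle `k`: `k` cycles from that very ISG
    (∀ i, i ≤ M.length → InitializedAt M i k → ∀ c,
      SettledBy M i (isg M c i) (k * M.length)) := by
  refine ⟨fun hk c => ?_, fun hk c i hi => ?_, fun i hi ⟨hk1, hk⟩ c => ?_⟩
  · refine settledBy_of_prefix M 0 _ (exists_isCodeState_stabAfter_bot _)
      (W := (List.replicate k M).flatten) ?_ fun N hN => prefix_window M 0 k ?_ hN (by simpa)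
    · rw [stabAfter_isg_zero, hk _ (Nat.le_add_left k c), isg_zero]
    -- `M.drop 0` is already one full cycle, so `1 + k` cycles are available.
    · have h := flatten_replicate_prefix M (Nat.le_add_left k 1)
      rw [flatten_replicate_add] at h
      simpa using h
  · refine settledBy_of_prefix M i _ (exists_isCodeState_stabAfter_bot _)
      (W := M.drop i ++ (List.replicate k M).flatten) ?_ fun N hN =>
        prefix_window M i k (List.prefix_refl _) ((Nat.le_add_left _ _).trans hN) (by simpa)
    rw [stabAfter_append, stabAfter_append, stabAfter_isg_drop, stabAfter_isg_zero,
      hk _ (Nat.le_add_left k (c + 1)), isg_zero]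
    exact stabAfter_mono bot_le _
  · obtain ⟨k, rfl⟩ := Nat.exists_eq_add_of_le' hk1
    refine settledBy_of_prefix M i _ (exists_isCodeState_stabAfter_bot _)
      -- With `k` now lowered by one, this is `k + 1` cycles rotated to start after position `i`;
      -- its end is again at position `i`, where periodicity is assumed.
      (W := M.drop i ++ ((List.replicate k M).flatten ++ M.take i)) ?_ fun N hN =>
        prefix_window M i (k + 1) ?_ hN ?_
    · rw [stabAfter_append, stabAfter_append, stabAfter_isg_drop, stabAfter_append,
        stabAfter_isg_zero, ← isg_eq_stabAfter_take, hk (c + 1 + k) (by omega)]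
      -- The periodic ISG arises from `⊥` by the part of `W` after `M.drop i`; measuring `M.drop i`
      -- beforehand can only enlarge the result.
      exact stabAfter_mono bot_le _
    · rw [List.prefix_append_right_inj, flatten_replicate_add, List.prefix_append_right_inj]
      simpa using List.take_prefix i M
    · refine le_of_eq_of_le ?_ hN
      simp only [List.length_append, List.length_drop, List.length_flatten, List.map_replicate,
        List.sum_replicate, List.length_take, smul_eq_mul, Nat.min_eq_left hi, Nat.add_mul]
      omega
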